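/- **Model.** Let $G$ be a finite connected simple graph with $n$ anonymous nodes; at every node $v$ the incident edges carry the distinct port numbers $0,\dots,\deg(v)-1$ (the two ends of an edge are numbered independently), and $v$ has a capacity $c(v)\in\mathbb N$, where $\sum_v c(v)\ge k$. There are $k$ robots with distinct IDs in $\mathbb N$, placed arbitrarily on the nodes. One of them is the shepherd, which every co-located robot recognizes and which is never Byzantine; at most $f$ of the other robots are strong Byzantine. The shepherd knows $n$, $k$ and its ID; every other robot knows only its own ID; the value $f$ is unknown to all robots. Memory is unlimited. Time proceeds in synchronous rounds. In each round a robot perceives the degree and the capacity of its node and the port through which it last entered, shouts one message, perceives of every other robot at its node whether it is the shepherd, the ID it shows and the message it shouts, updates its memory, and then stays, leaves through a port, or terminates (after which it never moves again). A non-Byzantine robot follows the given deterministic algorithm and shows its true ID. A strong Byzantine robot behaves arbitrarily: in each round it may show any single ID, shout any single message or none, and stay or leave through any port. *Byzantine dispersion* is achieved when all non-Byzantine robots have terminated and every node $u$ holds at most $c(u)$ non-Byzantine robots (the shepherd included). An *exploration sequence* is a finite sequence of integers $x_1,\dots,x_\ell$. A robot following it first leaves its node through port $0$; in step $i$, having entered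 the current node $u$ through port $p$, it leaves through port $(p+x_i)\bmod\deg(u)$. (On a one-node graph it stays.) This takes $\ell+1$ rounds. The sequence *explores* $G$ if, from every starting node, all nodes of $G$ are visited; it is *universal for $n$* (a UXS) if it explores every connected port-labelled graph with at most $n$ nodes. **Theorem.** For every $n$ there is a universal exploration sequence for $n$. Moreover, there is an absolute constant $C$ such that the following holds. For every choice of exploration sequences $U_n$ $(n\in\mathbb N)$, taking $X(n)$ rounds each, there is a deterministic algorithm (depending only on these sequences) such that for all $n,k,f$ with $f<\lfloor (k-1)/2\rfloor$, every connected capacitated $n$-node graph that is explored by $U_n$ (so every connected capacitated $n$-node graph, if $U_n$ is universal for $n$) and whose total capacity is at least $k$, every initial placement of $k$ robots with a trusted shepherd, and every behaviour of the at most $f$ strong Byzantine robots, the algorithm achieves Byzantine dispersion within $C\,(X(n)+n^3)$ rounds, that is, in $O(X(n)+n^3)$ rounds. -/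

import Mathlib

namespace Dispersion

/-- A finite simple graph whose nodes are anonymous and in which the edges at every node `v`
carry the distinct port numbers `0, …, deg v - 1` (the two ends of an edge are numbered
independently). -/
structure PortGraph (V : Type) where
  graph : SimpleGraph V
  deg : V → ℕ
  port : ∀ v, Fin (deg v) ≃ graph.neighborSet v

namespace PortGraph

variable {V : Type} (G : PortGraph V)

/-- The node reached from `v` through port `p`. -/
def nbr (v : V) (p : Fin (G.deg v)) : V := (G.port v p).1

theorem adj_nbr (v : V) (p : Fin (G.deg v)) : G.graph.Adj v (G.nbr v p) := (G.port v p).2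

/-- The port through which a robot enters `G.nbr v p` when it leaves `v` through port `p`. -/
def backPort (v : V) (p : Fin (G.deg v)) : Fin (G.deg (G.nbr v p)) :=
  (G.port (G.nbr v p)).symm ⟨v, (G.adj_nbr v p).symm⟩

/-- A place: a node together with the port through which it was last entered (`none` if the
robot has never moved). Leaving through port `p` leads to a new place; if there is no port `p`,
the robot stays. -/
def traverse (x : V × Option ℕ) (p : ℕ) : V × Option ℕ :=
  if h : p < G.deg x.1 then (G.nbr x.1 ⟨p, h⟩, some (G.backPort x.1 ⟨p, h⟩ : ℕ)) else x

/-- One step of an exploration sequence: a robot that entered `u` through port `q` leaves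
through port `(q + a) mod deg u`. -/
def uxsStep (x : V × Option ℕ) (a : ℤ) : V × Option ℕ :=
  G.traverse x ((((x.2.getD 0 : ℕ) : ℤ) + a) % (G.deg x.1 : ℤ)).toNat

/-- The nodes seen by a robot that starts at `v`, leaves through port `0` and then follows the
exploration sequence `U`. -/
def uxsVisited (U : List ℤ) (v : V) : List V :=
  v :: (U.scanl G.uxsStep (G.traverse (v, none) 0)).map Prod.fst

/-- Following `U` visits every node, from every starting node. -/
def ExploredBy (U : List ℤ) : Prop := ∀ v w : V, w ∈ G.uxsVisited U v

end PortGraph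

/-- The number of rounds (moves) taken by following the exploration sequence `U`: the initial
move through port `0` and one move for each entry. -/
def uxsRounds (U : List ℤ) : ℕ := U.length + 1

/-- `U` is a universal exploration sequence for the connected graphs of at most `n` nodes. -/
def IsUXS (n : ℕ) (U : List ℤ) : Prop :=
  ∀ (V : Type) [Fintype V] (G : PortGraph V),
    Fintype.card V ≤ n → G.graph.Connected → G.ExploredBy U

/-- What a robot perceives of the node on which it stands. -/
structure LocalView where
  degree : ℕ
  capacity : ℕ
  /-- the port through which the robot last entered, `none` if it has never moved -/
  entry : Option ℕ

/-- What all robots at a node perceive of one robot there in one round: whether it is the shepherd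
(which cannot be faked), the ID it shows, and the message it shouts (`none` is silence). -/
structure Shout (Msg : Type) where
  isShepherd : Bool
  label : ℕ
  msg : Option Msg

/-- What a robot does at the end of a round. -/
inductive Action where
  | stay
  | move (p : ℕ)
  | terminate

/-- A deterministic distributed algorithm for robots with unlimited memory. The shepherd is
given `n`, `k` and its own ID; every other robot is given its own ID and nothing else. In each
round a robot shouts a message determined by its memory and its view of the node, then receives
the shouts of the other robots at its node, updates its memory and acts. -/
structure Algorithm where
  Msg : Type
  Mem : Type
  initShepherd : (n k id : ℕ) → Mem
  initRobot : (id : ℕ) → Mem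
  send : Mem → LocalView → Option Msg
  step : Mem → LocalView → Multiset (Shout Msg) → Mem × Action

/-- A problem instance: a capacitated port-labelled graph with node set `V`, and a set `R` of
robots with distinct IDs and arbitrary initial positions, one of which is the shepherd and some
of which, never the shepherd, are Byzantine. -/
structure Instance (V R : Type) where
  G : PortGraph V
  cap : V → ℕ
  shepherd : R
  id : R → ℕ
  id_injective : Function.Injective id
  byz : Finset R
  shepherd_notMem_byz : shepherd ∉ byz
  start : R → V

/-- What a strong Byzantine robot does in one round: it shows any ID, shouts any message or none,
and stays (`none`) or leaves through a port of its choice. -/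
structure ByzAct (Msg : Type) where
  label : ℕ
  msg : Option Msg
  go : Option ℕ

/-- The status of one robot at the beginning of a round. The fields `mem` and `halted` are
meaningless for Byzantine robots. -/
structure Status (V Mem : Type) where
  place : V × Option ℕ
  mem : Mem
  halted : Bool

namespace Instance

open Classical in
/-- The status of a robot at the start. -/
noncomputable def init {V R : Type} [Fintype V] [Fintype R] (I : Instance V R) (A : Algorithm)
    (r : R) : Status V A.Mem where
  place := (I.start r, none)
  mem := if r = I.shepherd
    then A.initShepherd (Fintype.card V) (Fintype.card R) (I.id r) else A.initRobot (I.id r)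
  halted := false

variable {V R : Type} (I : Instance V R) (A : Algorithm)

/-- The view that a robot at the given place has of its node. -/
def view (x : V × Option ℕ) : LocalView where
  degree := I.G.deg x.1
  capacity := I.cap x.1
  entry := x.2

open Classical in
/-- The shout of robot `r` in a round that begins in configuration `σ` and in which the Byzantine
robots do `β`. A non-Byzantine robot that has terminated is still visible but silent. -/
noncomputable def shout (σ : R → Status V A.Mem) (β : R → ByzAct A.Msg) (r : R) :
    Shout A.Msg :=
  if r ∈ I.byz then ⟨false, (β r).label, (β r).msg⟩
  else ⟨decide (r = I.shepherd), I.id r,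
    if (σ r).halted then none else A.send (σ r).mem (I.view (σ r).place)⟩

open Classical in
/-- The shouts that robot `r` receives: one from each other robot at the same node. -/
noncomputable def received [Fintype R] (σ : R → Status V A.Mem) (β : R → ByzAct A.Msg) (r : R) :
    Multiset (Shout A.Msg) :=
  (Finset.univ.filter fun r' => r' ≠ r ∧ (σ r').place.1 = (σ r).place.1).val.map
    (I.shout A σ β)

/-- The effect of an action of a non-Byzantine robot. -/
def act {Mem : Type} (x : V × Option ℕ) : Mem × Action → Status V Mem
  | (m, .stay) => ⟨x, m, false⟩
  | (m, .move p) => ⟨I.G.traverse x p, m, false⟩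
  | (m, .terminate) => ⟨x, m, true⟩

open Classical in
/-- One synchronous round. A robot that has terminated never moves again. -/
noncomputable def next [Fintype R] (σ : R → Status V A.Mem) (β : R → ByzAct A.Msg) (r : R) :
    Status V A.Mem :=
  if r ∈ I.byz then
    { σ r with place := ((β r).go.map (I.G.traverse (σ r).place)).getD (σ r).place }
  else if (σ r).halted then σ r
  else I.act (σ r).place
    (A.step (σ r).mem (I.view (σ r).place) (I.received A σ β r))

/-- The configuration after `t` rounds when the Byzantine robots behave as in `β`. As the
algorithm is deterministic, the behaviours `β` also cover all adaptive adversaries. -/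
noncomputable def run [Fintype V] [Fintype R] (β : ℕ → R → ByzAct A.Msg) :
    ℕ → R → Status V A.Mem
  | 0 => I.init A
  | t + 1 => I.next A (run β t) (β t)

/-- Byzantine dispersion is achieved: every non-Byzantine robot (including the shepherd) has
terminated, and every node `u` holds at most `cap u` non-Byzantine robots. -/
def Dispersed {Mem : Type} (σ : R → Status V Mem) : Prop :=
  (∀ r, r ∉ I.byz → (σ r).halted = true) ∧
    ∀ u, {r | r ∉ I.byz ∧ (σ r).place.1 = u}.ncard ≤ I.cap u

/-- Whatever the Byzantine robots do, the algorithm achieves Byzantine dispersion within `T`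
rounds. -/
def SolvedWithin [Fintype V] [Fintype R] (T : ℕ) : Prop :=
  ∀ β : ℕ → R → ByzAct A.Msg, ∃ t ≤ T, I.Dispersed (I.run A β t)

end Instance

end Dispersion

/-!
Up to renaming the nodes, there are only finitely many connected port-labelled graphs on at most `n`
nodes with a start and a target node. Extending a sequence for one of them after another, so as to
walk to the target from wherever the sequence so far has led, gives a universal exploration
sequence.

The shepherd first follows `U n` and takes along every robot that it meets, so that afterwards all
non-Byzantine robots are with it. As these are more than half of all robots, the shepherd recognizes
the node where it has parked them by counting: they serve as a token. It builds a map of the graph,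
a closed walk that enters every known node by exactly one marked step: to decide whether a port
leads to a new node, it parks the token behind the port and walks along the closed walk, and if it
does not meet the token, it inserts a detour through the port. Each of the at most `2 * n` steps of
the walk takes `n` such probes of `O(n)` rounds, hence the term `n ^ 3`.

Finally the shepherd calls the roll of the robots at its node. False IDs only make the roll longer
than necessary, but never longer than `k - 1`. It leads the robots along the map once more and at
each new node `v` lets the next `cap v` robots on the roll settle. Since the total capacity exceeds
the length of the roll, there is a node with room for one more than the rest of the roll, and there
the shepherd settles, too.
-/

namespace Dispersion

/-! ### Universal exploration sequences -/

namespace PortGraph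

variable {V W : Type} (G : PortGraph V)

theorem nbr_backPort (v : V) (p : Fin (G.deg v)) : G.nbr (G.nbr v p) (G.backPort v p) = v := by
  unfold backPort nbr
  rw [Equiv.apply_symm_apply]

theorem exists_nbr_eq {v w : V} (h : G.graph.Adj v w) : ∃ p, G.nbr v p = w :=
  ⟨(G.port v).symm ⟨w, h⟩, by simp [nbr]⟩

theorem deg_le_card [Fintype V] (v : V) : G.deg v ≤ Fintype.card V := by
  simpa using Fintype.card_le_of_injective (G.nbr v)
    (Subtype.val_injective.comp (G.port v).injective)

theorem exists_fst_uxsStep_eq {x : V × Option ℕ} {w : V} (h : G.graph.Adj x.1 w) :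
    ∃ a, (G.uxsStep x a).1 = w := by
  obtain ⟨p, rfl⟩ := G.exists_nbr_eq h
  have hp : ((p : ℕ) : ℤ) % (G.deg x.1 : ℤ) = (p : ℕ) := by
    exact_mod_cast Nat.mod_eq_of_lt p.2
  exact ⟨(p : ℤ) - (x.2.getD 0 : ℕ), by simp [uxsStep, hp, traverse]⟩

theorem exists_fst_foldl_uxsStep_eq (hG : G.graph.Connected) (w : V) (x : V × Option ℕ) :
    ∃ U : List ℤ, (U.foldl G.uxsStep x).1 = w := by
  obtain ⟨π⟩ := hG.preconnected x.1 w
  generalize hv : x.1 = v at π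
  induction π generalizing x with
  | nil => exact ⟨[], hv⟩
  | cons h _ ih =>
    obtain ⟨a, ha⟩ := G.exists_fst_uxsStep_eq (hv ▸ h)
    obtain ⟨U, hU⟩ := ih (G.uxsStep x a) ha
    exact ⟨a :: U, hU⟩

theorem mem_uxsVisited_append {U : List ℤ} {v w : V} (h : w ∈ G.uxsVisited U v) (U' : List ℤ) :
    w ∈ G.uxsVisited (U ++ U') v := by
  simp only [uxsVisited, List.scanl_append, List.map_append, List.mem_cons,
    List.mem_append] at h ⊢
  exact h.imp_right .inl

theorem foldl_mem_uxsVisited (U : List ℤ) (v : V) :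
    (U.foldl G.uxsStep (G.traverse (v, none) 0)).1 ∈ G.uxsVisited U v :=
  List.mem_cons_of_mem _ (List.mem_map_of_mem (List.mem_of_getLast? List.getLast?_scanl))

theorem exists_mem_uxsVisited_append (hG : G.graph.Connected) (U : List ℤ) (v w : V) :
    ∃ U', w ∈ G.uxsVisited (U ++ U') v := by
  obtain ⟨U', hU'⟩ := G.exists_fst_foldl_uxsStep_eq hG w
    (U.foldl G.uxsStep (G.traverse (v, none) 0))
  rw [← List.foldl_append] at hU'
  exact ⟨U', hU' ▸ G.foldl_mem_uxsVisited (U ++ U') v⟩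

theorem exists_forall_mem_uxsVisited {ι : Type*} [Finite ι] {V : ι → Type}
    (G : ∀ i, PortGraph (V i)) (hG : ∀ i, (G i).graph.Connected) (v w : ∀ i, V i) :
    ∃ U : List ℤ, ∀ i, w i ∈ (G i).uxsVisited U (v i) := by
  classical
  have := Fintype.ofFinite ι
  suffices ∀ s : Finset ι, ∃ U : List ℤ, ∀ i ∈ s, w i ∈ (G i).uxsVisited U (v i) by
    simpa using this Finset.univ
  intro s
  induction s using Finset.induction_on with
  | empty => exact ⟨[], by simp⟩
  | insert j s _ ih =>
    obtain ⟨U, hU⟩ := ih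
    obtain ⟨U', hU'⟩ := (G j).exists_mem_uxsVisited_append (hG j) U (v j) (w j)
    exact ⟨U ++ U', Finset.forall_mem_insert .. |>.2
      ⟨hU', fun i hi => (G i).mem_uxsVisited_append (hU i hi) U'⟩⟩

instance finite [Finite V] : Finite (PortGraph V) := by
  have := Fintype.ofFinite V
  refine Finite.of_surjective
    (α := Σ (g : SimpleGraph V) (d : V → Fin (Fintype.card V + 1)),
      ∀ v, Fin (d v) ≃ g.neighborSet v)
    (fun x => ⟨x.1, fun v => x.2.1 v, x.2.2⟩) fun G => ?_
  exact ⟨⟨G.graph, fun v => ⟨G.deg v, Nat.lt_succ_of_le (G.deg_le_card v)⟩, G.port⟩, rfl⟩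

/-- The port-labelled graph that results from renaming the nodes of `G` along `e`; it reduces
universality to the node sets `Fin m`. -/
def relabel (e : W ≃ V) : PortGraph W where
  graph := G.graph.comap e
  deg w := G.deg (e w)
  port w := (G.port (e w)).trans ((SimpleGraph.Iso.comap e G.graph).mapNeighborSet w).symm

variable (e : W ≃ V)

theorem val_port_symm_congr {v v' w : V} (hv : v = v') (h : G.graph.Adj v w)
    (h' : G.graph.Adj v' w) :
    ((G.port v).symm ⟨w, h⟩ : ℕ) = (G.port v').symm ⟨w, h'⟩ := by
  subst hv
  rfl

theorem relabel_nbr (w : W) (p : Fin (G.deg (e w))) :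
    e ((G.relabel e).nbr w p) = G.nbr (e w) p :=
  e.apply_symm_apply _

theorem relabel_backPort (w : W) (p : Fin (G.deg (e w))) :
    ((G.relabel e).backPort w p : ℕ) = G.backPort (e w) p :=
  G.val_port_symm_congr (G.relabel_nbr e w p) _ _

theorem relabel_traverse (x : W × Option ℕ) (p : ℕ) :
    Prod.map e id ((G.relabel e).traverse x p) = G.traverse (Prod.map e id x) p := by
  by_cases h : p < G.deg (e x.1)
  · have h' : p < (G.relabel e).deg x.1 := h
    simp only [traverse, Prod.map_fst, dif_pos h, dif_pos h']
    exact Prod.ext (G.relabel_nbr e x.1 ⟨p, h⟩)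
      (congrArg some (G.relabel_backPort e x.1 ⟨p, h⟩))
  · have h' : ¬ p < (G.relabel e).deg x.1 := h
    simp [traverse, h, h']

theorem relabel_uxsStep (x : W × Option ℕ) (a : ℤ) :
    Prod.map e id ((G.relabel e).uxsStep x a) = G.uxsStep (Prod.map e id x) a :=
  G.relabel_traverse e x _

theorem relabel_scanl_uxsStep (U : List ℤ) (x : W × Option ℕ) :
    (U.scanl (G.relabel e).uxsStep x).map (Prod.map e id) =
      U.scanl G.uxsStep (Prod.map e id x) := by
  induction U generalizing x with
  | nil => simp
  | cons a U ih => simp [ih, relabel_uxsStep]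

theorem relabel_uxsVisited (U : List ℤ) (w : W) :
    ((G.relabel e).uxsVisited U w).map e = G.uxsVisited U (e w) := by
  have h : G.traverse (e w, none) 0 = Prod.map e id ((G.relabel e).traverse (w, none) 0) :=
    (G.relabel_traverse e (w, none) 0).symm
  simp [uxsVisited, h, ← relabel_scanl_uxsStep]

theorem relabel_connected (h : G.graph.Connected) : (G.relabel e).graph.Connected :=
  (SimpleGraph.Iso.comap e G.graph).connected_iff.2 h

end PortGraph

theorem exists_isUXS (n : ℕ) : ∃ U : List ℤ, IsUXS n U := by
  let Request := {x : Σ m : Fin (n + 1), PortGraph (Fin m) × Fin m × Fin m //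
    x.2.1.graph.Connected}
  obtain ⟨U, hU⟩ := PortGraph.exists_forall_mem_uxsVisited (ι := Request)
    (fun i => i.1.2.1) (fun i => i.2) (fun i => i.1.2.2.1) fun i => i.1.2.2.2
  refine ⟨U, fun V _ G hV hG v w => ?_⟩
  let e := (Fintype.equivFin V).symm
  have h := hU ⟨⟨⟨Fintype.card V, Nat.lt_succ_of_le hV⟩, G.relabel e, e.symm v, e.symm w⟩,
    G.relabel_connected e hG⟩
  simpa [PortGraph.relabel_uxsVisited] using List.mem_map_of_mem (f := e) h

/-! ### Maps of the graph as closed walks -/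

/-- A walk, given by the ports to take; `true` marks the steps that enter a node for the first
time. The shepherd can store such a walk, since it does not mention the anonymous nodes. -/
abbrev MarkedWalk := List (ℕ × Bool)

namespace PortGraph

variable {V : Type} (G : PortGraph V)

/-- The node reached from `v` through port `p`, reduced modulo the degree so that every number
is a port (and on a one-node graph, where `p % 0 = p`, the walk stays). -/
def go (v : V) (p : ℕ) : V := (G.traverse (v, none) (p % G.deg v)).1

/-- The node at which a walk from `v` ends. -/
def endpoint (v : V) (s : MarkedWalk) : V := s.foldl (fun u b => G.go u b.1) v

/-- The nodes of a walk from `v`, without its endpoint. -/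
def passed : V → MarkedWalk → List V
  | _, [] => []
  | v, b :: s => v :: passed (G.go v b.1) s

/-- The nodes entered by the marked steps of a walk from `v`. -/
def marked : V → MarkedWalk → List V
  | _, [] => []
  | v, (p, true) :: s => G.go v p :: marked (G.go v p) s
  | v, (p, false) :: s => marked (G.go v p) s

/-- The nodes known from a walk that starts at `v`: `v` itself and those entered by the marked
steps. -/
def discovered (v : V) (s : MarkedWalk) : List V := v :: G.marked v s

theorem fst_traverse_congr {x y : V × Option ℕ} (h : x.1 = y.1) (p : ℕ) :
    (G.traverse x p).1 = (G.traverse y p).1 := by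
  obtain ⟨u, a⟩ := x
  obtain ⟨v, b⟩ := y
  obtain rfl : u = v := h
  unfold traverse
  split_ifs <;> rfl

theorem fst_traverse_mod (x : V × Option ℕ) (p : ℕ) :
    (G.traverse x (p % G.deg x.1)).1 = G.go x.1 p :=
  G.fst_traverse_congr (x := x) (y := (x.1, none)) rfl _

theorem go_eq_nbr (v : V) (p : Fin (G.deg v)) : G.go v p = G.nbr v p := by
  simp [go, traverse, Nat.mod_eq_of_lt p.2]

theorem exists_go_eq_of_adj {v w : V} (h : G.graph.Adj v w) : ∃ p < G.deg v, G.go v p = w := by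
  obtain ⟨p, rfl⟩ := G.exists_nbr_eq h
  exact ⟨p, p.2, G.go_eq_nbr v p⟩

theorem go_entry (x : V × Option ℕ) (p : ℕ) :
    G.go (G.go x.1 p) ((G.traverse x (p % G.deg x.1)).2.getD 0) = x.1 := by
  rw [← fst_traverse_mod]
  by_cases h : p % G.deg x.1 < G.deg x.1
  · rw [show G.traverse x (p % G.deg x.1) = _ from dif_pos h]
    exact (G.go_eq_nbr _ (G.backPort x.1 ⟨_, h⟩)).trans (G.nbr_backPort _ _)
  · have h0 : G.deg x.1 = 0 := by
      by_contra h0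
      exact h (Nat.mod_lt _ (Nat.pos_of_ne_zero h0))
    simp [go, traverse, h0]

@[simp] theorem endpoint_nil (v : V) : G.endpoint v [] = v := rfl

@[simp] theorem endpoint_cons (v : V) (b : ℕ × Bool) (s : MarkedWalk) :
    G.endpoint v (b :: s) = G.endpoint (G.go v b.1) s := rfl

@[simp] theorem endpoint_append (v : V) (s s' : MarkedWalk) :
    G.endpoint v (s ++ s') = G.endpoint (G.endpoint v s) s' := List.foldl_append ..

theorem passed_append (v : V) (s s' : MarkedWalk) :
    G.passed v (s ++ s') = G.passed v s ++ G.passed (G.endpoint v s) s' := by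
  induction s generalizing v with
  | nil => rfl
  | cons b s ih => simp [passed, ih]

theorem marked_append (v : V) (s s' : MarkedWalk) :
    G.marked v (s ++ s') = G.marked v s ++ G.marked (G.endpoint v s) s' := by
  induction s generalizing v with
  | nil => rfl
  | cons b s ih => obtain ⟨p, _ | _⟩ := b <;> simp [marked, ih]

variable {G} {r : V} {A B : MarkedWalk}

theorem endpoint_mem_of_closed (h : G.endpoint r (A ++ B) = r) :
    G.endpoint r A ∈ r :: G.passed r (A ++ B) := by
  cases B with
  | nil => simp_all
  | cons b B => simp [passed_append, passed]

theorem endpoint_rotate_of_closed (h : G.endpoint r (A ++ B) = r) :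
    G.endpoint (G.endpoint r A) (B ++ A) = G.endpoint r A := by
  rw [endpoint_append] at h ⊢
  rw [h]

theorem mem_passed_rotate_of_closed (h : G.endpoint r (A ++ B) = r) (v : V) :
    v ∈ G.endpoint r A :: G.passed (G.endpoint r A) (B ++ A) ↔ v ∈ r :: G.passed r (A ++ B) := by
  have hperm : (G.passed (G.endpoint r A) (B ++ A)).Perm (G.passed r (A ++ B)) := by
    rw [passed_append, passed_append, ← endpoint_append, h]
    exact List.perm_append_comm
  have hstart : r ∈ G.endpoint r A :: G.passed (G.endpoint r A) (B ++ A) := by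
    have := endpoint_mem_of_closed (endpoint_rotate_of_closed h)
    rwa [← endpoint_append, h] at this
  have hend := endpoint_mem_of_closed h
  rw [List.mem_cons, hperm.mem_iff] at hstart ⊢
  rw [List.mem_cons] at hend ⊢
  constructor
  · rintro (rfl | hv)
    exacts [hend, .inr hv]
  · rintro (rfl | hv)
    exacts [hstart, .inr hv]

section Detour

variable {p q : ℕ} (hq : G.go (G.go (G.endpoint r A) p) q = G.endpoint r A)
include hq

theorem passed_detour_perm :
    (G.passed r (A ++ (p, true) :: (q, false) :: B)).Perm
      (G.endpoint r A :: G.go (G.endpoint r A) p :: G.passed r (A ++ B)) := by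
  simp only [passed_append, passed, hq]
  exact List.perm_middle.trans (List.perm_middle.cons _)

theorem discovered_detour_perm :
    (G.discovered r (A ++ (p, true) :: (q, false) :: B)).Perm
      (G.go (G.endpoint r A) p :: G.discovered r (A ++ B)) := by
  simp only [discovered, marked_append, marked, hq]
  exact (List.perm_middle.cons r).trans (List.Perm.swap ..)

end Detour

variable (G r A B) in
/-- What the shepherd knows while it explores: the closed walk `A ++ B` from `r` enters each of
its nodes (other than `r`) by exactly one marked step, and the neighbors of the nodes of `A`, up
to but excluding its endpoint, are all on the walk. -/
structure IsMap : Prop where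
  closed : G.endpoint r (A ++ B) = r
  nodup : (G.discovered r (A ++ B)).Nodup
  mem_passed_iff : ∀ v, v ∈ r :: G.passed r (A ++ B) ↔ v ∈ G.discovered r (A ++ B)
  length_eq : (A ++ B).length = 2 * (G.marked r (A ++ B)).length
  probed : ∀ v ∈ G.passed r A, ∀ w, G.graph.Adj v w → w ∈ G.discovered r (A ++ B)

namespace IsMap

theorem nil : G.IsMap r [] [] := by
  constructor <;> simp [discovered, passed, marked]

theorem length_add_two_le [Fintype V] (h : G.IsMap r A B) :
    (A ++ B).length + 2 ≤ 2 * Fintype.card V := by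
  have hcard := h.nodup.length_le_card
  rw [discovered, List.length_cons] at hcard
  have := h.length_eq
  omega

theorem mem_passed_rotate_iff (h : G.IsMap r A B) (v : V) :
    v ∈ G.endpoint r A :: G.passed (G.endpoint r A) (B ++ A) ↔ v ∈ G.discovered r (A ++ B) :=
  (mem_passed_rotate_of_closed h.closed v).trans (h.mem_passed_iff v)

theorem insert (h : G.IsMap r A B) {p q : ℕ}
    (hq : G.go (G.go (G.endpoint r A) p) q = G.endpoint r A)
    (hp : G.go (G.endpoint r A) p ∉ G.discovered r (A ++ B)) :
    G.IsMap r A ((p, true) :: (q, false) :: B) where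
  closed := by simpa [hq] using h.closed
  nodup := (discovered_detour_perm hq).nodup_iff.2 (List.nodup_cons.2 ⟨hp, h.nodup⟩)
  mem_passed_iff v := by
    have hend := (h.mem_passed_iff _).1 (endpoint_mem_of_closed h.closed)
    have hv := h.mem_passed_iff v
    rw [(discovered_detour_perm hq).mem_iff, List.mem_cons, (passed_detour_perm hq).mem_iff]
    simp only [List.mem_cons] at hv ⊢
    grind
  length_eq := by
    have hlen := (discovered_detour_perm (B := B) hq).length_eq
    have := h.length_eq
    simp only [discovered, List.length_cons, List.length_append] at hlen this ⊢
    omega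
  probed v hv w hw :=
    (discovered_detour_perm hq).mem_iff.2 (List.mem_cons_of_mem _ (h.probed v hv w hw))

theorem advance {b : ℕ × Bool} (h : G.IsMap r A (b :: B))
    (hend : ∀ w, G.graph.Adj (G.endpoint r A) w → w ∈ G.discovered r (A ++ b :: B)) :
    G.IsMap r (A ++ [b]) B := by
  have happ : A ++ [b] ++ B = A ++ b :: B := List.append_cons .. |>.symm
  constructor <;> rw [happ]
  · exact h.closed
  · exact h.nodup
  · exact h.mem_passed_iff
  · exact h.length_eq
  · intro v hv
    rw [passed_append, List.mem_append] at hv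
    rcases hv with hv | hv
    · exact h.probed v hv
    · obtain rfl : v = G.endpoint r A := by simpa [passed] using hv
      exact hend

theorem mem_discovered (hG : G.graph.Connected) (h : G.IsMap r A [])
    (hend : ∀ w, G.graph.Adj (G.endpoint r A) w → w ∈ G.discovered r A) (v : V) :
    v ∈ G.discovered r A := by
  obtain ⟨hclosed, -, hmem, -, hprobed⟩ := h
  simp only [List.append_nil] at hclosed hmem hprobed
  have hadj : ∀ u ∈ G.discovered r A, ∀ w, G.graph.Adj u w → w ∈ G.discovered r A := by
    intro u hu
    rcases List.mem_cons.1 ((hmem u).2 hu) with rfl | hu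
    · rwa [hclosed] at hend
    · exact hprobed u hu
  have hreach := (SimpleGraph.reachable_iff_reflTransGen r v).1 (hG.preconnected r v)
  induction hreach with
  | refl => exact List.mem_cons_self
  | tail _ hw ih => exact hadj _ ih _ hw

end IsMap

end PortGraph

/-! ### Robots that obey the shepherd -/

/-- What the shepherd shouts: the robots with the listed IDs settle, the others at its node leave
through the given port (and stay if there is none). -/
structure Command where
  settle : List ℕ
  follow : Option ℕ

/-- A program for the shepherd, as a coroutine: the command and the action of a round depend on
the view of the node, the remaining program also on the shouts received in this round. -/
inductive Prog where
  | halt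
  | round (cmd : LocalView → Command × Action)
      (next : LocalView → Multiset (Shout Command) → Prog)

open Classical in
/-- The command that a robot hears when it receives `M`, in which at most one shout is the
shepherd's. -/
noncomputable def heard (M : Multiset (Shout Command)) : Option Command :=
  if h : ∃ s ∈ M, s.isShepherd = true then h.choose.msg else none

theorem heard_eq_msg {M : Multiset (Shout Command)} {s : Shout Command} (hM : s ∈ M)
    (hs : s.isShepherd = true) (huniq : ∀ s' ∈ M, s'.isShepherd = true → s' = s) :
    heard M = s.msg := by
  have h : ∃ s ∈ M, s.isShepherd = true := ⟨s, hM, hs⟩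
  rw [heard, dif_pos h, huniq _ h.choose_spec.1 h.choose_spec.2]

theorem heard_eq_none {M : Multiset (Shout Command)} (h : ∀ s ∈ M, s.isShepherd ≠ true) :
    heard M = none :=
  dif_neg fun ⟨s, hM, hs⟩ => h s hM hs

/-- The action of the robot with the given ID when it hears the given command. -/
def obey (id : ℕ) : Option Command → Action
  | none => .stay
  | some c => if id ∈ c.settle then .terminate else (c.follow.map Action.move).getD .stay

/-- The algorithm in which the shepherd runs the program `main n k` and the other robots obey its
commands. -/
noncomputable abbrev shepherding (main : ℕ → ℕ → Prog) : Algorithm where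
  Msg := Command
  Mem := Prog ⊕ ℕ
  initShepherd n k _ := .inl (main n k)
  initRobot id := .inr id
  send
    | .inl (.round cmd _), v => some (cmd v).1
    | _, _ => none
  step
    | .inl (.round cmd next), v, M => (.inl (next v M), (cmd v).2)
    | .inl .halt, _, _ => (.inl .halt, .terminate)
    | .inr id, _, M => (.inr id, obey id (heard M))

/-- The robot is at node `v` and has not terminated. -/
def Status.ActiveAt {V Mem : Type} (s : Status V Mem) (v : V) : Prop :=
  s.halted = false ∧ s.place.1 = v

/-- The robot has terminated at node `v`. -/
def Status.SettledAt {V Mem : Type} (s : Status V Mem) (v : V) : Prop :=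
  s.halted = true ∧ s.place.1 = v

theorem Status.ActiveAt.not_settledAt {V Mem : Type} {s : Status V Mem} {u v : V}
    (h : s.ActiveAt u) : ¬s.SettledAt v :=
  fun h' => Bool.false_ne_true (h.1.symm.trans h'.1)

namespace Instance

variable {V R : Type} {I : Instance V R} {r r' : R}

variable (I) in
/-- The non-Byzantine robots other than the shepherd. -/
def IsFollower (r : R) : Prop := r ∉ I.byz ∧ r ≠ I.shepherd

section Received

variable {A : Algorithm} {σ : R → Status V A.Mem} {β : R → ByzAct A.Msg}

theorem isShepherd_shout : (I.shout A σ β r).isShepherd = true ↔ r = I.shepherd := by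
  by_cases hb : r ∈ I.byz
  · have hr : r ≠ I.shepherd := fun h => I.shepherd_notMem_byz (h ▸ hb)
    simp [shout, hb, hr]
  · simp [shout, hb]

variable [Fintype R]

theorem mem_received {s : Shout A.Msg} :
    s ∈ I.received A σ β r ↔
      ∃ r', (r' ≠ r ∧ (σ r').place.1 = (σ r).place.1) ∧ I.shout A σ β r' = s := by
  simp [received]

theorem card_received :
    (I.received A σ β r).card = {r' | r' ≠ r ∧ (σ r').place.1 = (σ r).place.1}.ncard := by
  classical
  rw [received, Multiset.card_map, Finset.card_val, ← Set.ncard_coe_finset, Finset.coe_filter_univ]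

theorem next_of_halted (hb : r ∉ I.byz) (h : (σ r).halted = true) : I.next A σ β r = σ r := by
  rw [next, if_neg hb, if_pos h]

end Received

variable [Fintype R] {main : ℕ → ℕ → Prog} {σ : R → Status V (shepherding main).Mem}
  {P : Prog} {x : V × Option ℕ} {v : V} {cmd : LocalView → Command × Action}
  {nxt : LocalView → Multiset (Shout Command) → Prog}

variable (I σ P x) in
/-- The shepherd is active at place `x` and about to execute the program `P`; the followers
remember their IDs. -/
structure Running : Prop where
  mem_shepherd : (σ I.shepherd).mem = .inl P
  place_shepherd : (σ I.shepherd).place = x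
  halted_shepherd : (σ I.shepherd).halted = false
  mem_follower : ∀ r, I.IsFollower r → (σ r).mem = .inr (I.id r)

namespace Running

variable (h : I.Running σ (.round cmd nxt) x) (β : R → ByzAct Command)
include h

omit [Fintype R] in
theorem msg_shout_shepherd :
    (I.shout (shepherding main) σ β I.shepherd).msg = some (cmd (I.view x)).1 := by
  simp [shout, I.shepherd_notMem_byz, h.halted_shepherd, h.mem_shepherd, h.place_shepherd]

open Classical in
theorem heard_received (hr : r ≠ I.shepherd) :
    heard (I.received (shepherding main) σ β r) =
      if (σ r).place.1 = x.1 then some (cmd (I.view x)).1 else none := by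
  split_ifs with hx
  · rw [← h.msg_shout_shepherd β]
    refine heard_eq_msg (mem_received.2 ⟨_, ⟨hr.symm, ?_⟩, rfl⟩) (isShepherd_shout.2 rfl) ?_
    · rw [h.place_shepherd, hx]
    · intro s hs hsh
      obtain ⟨r', -, rfl⟩ := mem_received.1 hs
      rw [isShepherd_shout.1 hsh]
  · refine heard_eq_none fun s hs hsh => hx ?_
    obtain ⟨r', ⟨-, hr'⟩, rfl⟩ := mem_received.1 hs
    rw [← hr', isShepherd_shout.1 hsh, h.place_shepherd]

open Classical in
theorem next_follower (hr : I.IsFollower r) (hh : (σ r).halted = false) :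
    I.next (shepherding main) σ β r = I.act (σ r).place (.inr (I.id r),
      obey (I.id r) (if (σ r).place.1 = x.1 then some (cmd (I.view x)).1 else none)) := by
  simp [next, hr.1, hh, h.mem_follower r hr, h.heard_received β hr.2]

theorem activeAt_next_of_idle (hr : I.IsFollower r) (ha : (σ r).ActiveAt v)
    (hidle : v = x.1 → I.id r ∉ (cmd (I.view x)).1.settle ∧ (cmd (I.view x)).1.follow = none) :
    (I.next (shepherding main) σ β r).ActiveAt v := by
  obtain ⟨hh, rfl⟩ := ha
  rw [h.next_follower β hr hh]
  by_cases hx : (σ r).place.1 = x.1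
  · simp [hx, obey, hidle, act, Status.ActiveAt]
  · simp [hx, obey, act, Status.ActiveAt]

theorem settledAt_next_iff (hr : I.IsFollower r) :
    (I.next (shepherding main) σ β r).SettledAt v ↔ (σ r).SettledAt v ∨
      v = x.1 ∧ (σ r).ActiveAt x.1 ∧ I.id r ∈ (cmd (I.view x)).1.settle := by
  by_cases hh : (σ r).halted = true
  · simp [next_of_halted hr.1 hh, Status.ActiveAt, hh]
  · rw [Bool.not_eq_true] at hh
    rw [h.next_follower β hr hh]
    by_cases hx : (σ r).place.1 = x.1
    · by_cases hs : I.id r ∈ (cmd (I.view x)).1.settle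
      · simp [hx, hs, hh, obey, act, Status.ActiveAt, Status.SettledAt, eq_comm]
      · cases hp : (cmd (I.view x)).1.follow <;>
          simp [hx, hs, hh, hp, obey, act, Status.SettledAt]
    · simp [hx, hh, obey, act, Status.ActiveAt, Status.SettledAt]

theorem activeAt_next_of_follow (hr : I.IsFollower r) (ha : (σ r).ActiveAt x.1)
    (hs : I.id r ∉ (cmd (I.view x)).1.settle) {p : ℕ} (hp : (cmd (I.view x)).1.follow = some p) :
    (I.next (shepherding main) σ β r).ActiveAt (I.G.traverse x p).1 := by
  obtain ⟨hh, hx⟩ := ha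
  rw [h.next_follower β hr hh]
  simpa [hx, obey, hs, hp, act, Status.ActiveAt] using I.G.fst_traverse_congr hx p

theorem next_shepherd :
    I.next (shepherding main) σ β I.shepherd =
      I.act x (.inl (nxt (I.view x) (I.received (shepherding main) σ β I.shepherd)),
        (cmd (I.view x)).2) := by
  simp [next, I.shepherd_notMem_byz, h.mem_shepherd, h.place_shepherd, h.halted_shepherd]

theorem mem_next_follower (hr : I.IsFollower r) :
    (I.next (shepherding main) σ β r).mem = .inr (I.id r) := by
  by_cases hh : (σ r).halted = true
  · rw [next_of_halted hr.1 hh, h.mem_follower r hr]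
  · rw [h.next_follower β hr (by simpa using hh)]
    cases obey _ _ <;> rfl

theorem move {p : ℕ} (hp : (cmd (I.view x)).2 = .move p) :
    I.Running (I.next (shepherding main) σ β)
      (nxt (I.view x) (I.received (shepherding main) σ β I.shepherd)) (I.G.traverse x p) := by
  have hs := h.next_shepherd β
  rw [hp] at hs
  constructor
  · rw [hs, act]
  · rw [hs, act]
  · rw [hs, act]
  · exact fun r => h.mem_next_follower β

theorem stay (hp : (cmd (I.view x)).2 = .stay) :
    I.Running (I.next (shepherding main) σ β)
      (nxt (I.view x) (I.received (shepherding main) σ β I.shepherd)) x := by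
  have hs := h.next_shepherd β
  rw [hp] at hs
  constructor
  · rw [hs, act]
  · rw [hs, act]
  · rw [hs, act]
  · exact fun r => h.mem_next_follower β

end Running

end Instance

/-! ### Gathering, and the other robots as a token -/

/-- Port `p`, reduced modulo the degree. -/
def portMod (p : ℕ) (v : LocalView) : ℕ := p % v.degree

/-- The port that an exploration sequence with entry `a` prescribes. -/
def portUxs (a : ℤ) (v : LocalView) : ℕ :=
  ((((v.entry.getD 0 : ℕ) : ℤ) + a) % (v.degree : ℤ)).toNat

/-- The port of entry. -/
def portBack (v : LocalView) : ℕ := v.entry.getD 0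

namespace Prog

/-- The shepherd moves through the port chosen by `m`, together with all robots at its node. -/
def lead (m : LocalView → ℕ) (next : Prog) : Prog :=
  .round (fun v => (⟨[], some (m v)⟩, .move (m v))) fun _ _ => next

/-- The shepherd moves alone through the port chosen by `m`. -/
def solo (m : LocalView → ℕ) (next : LocalView → Multiset (Shout Command) → Prog) : Prog :=
  .round (fun v => (⟨[], none⟩, .move (m v))) next

/-- The shepherd leads along an exploration sequence, after the initial move through port `0`. -/
def leadUxs : List ℤ → Prog → Prog
  | [], next => next
  | a :: U, next => lead (portUxs a) (leadUxs U next)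

/-- The shepherd follows an exploration sequence and takes along all robots that it meets. -/
def gather (U : List ℤ) (next : Prog) : Prog :=
  lead (fun _ => 0) (leadUxs U next)

end Prog

namespace Instance

variable {V R : Type} [Fintype R] {I : Instance V R} {main : ℕ → ℕ → Prog}
  {σ : R → Status V (shepherding main).Mem} {P : Prog} {x : V × Option ℕ} {v w : V} {r : R}
  {nxt : LocalView → Multiset (Shout Command) → Prog} {m : LocalView → ℕ} {seen : Set V}

theorem Running.activeAt_next_of_lead (h : I.Running σ (.lead m P) x)
    (β : R → ByzAct Command) (hr : I.IsFollower r) (ha : (σ r).ActiveAt x.1) :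
    (I.next (shepherding main) σ β r).ActiveAt (I.G.traverse x (m (I.view x))).1 :=
  Running.activeAt_next_of_follow h β hr ha List.not_mem_nil rfl

variable (I σ P x seen) in
/-- The shepherd has emptied the nodes in `seen`: every follower is active, and one at a node in
`seen` is with the shepherd at place `x`. -/
structure Gathering : Prop extends I.Running σ P x where
  follower : ∀ r, I.IsFollower r → ∃ v, (σ r).ActiveAt v ∧ (v ∈ seen → v = x.1)

theorem Gathering.lead (h : I.Gathering σ (.lead m P) x seen) (β : R → ByzAct Command) :
    I.Gathering (I.next (shepherding main) σ β) P (I.G.traverse x (m (I.view x)))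
      (insert x.1 seen) where
  toRunning := h.toRunning.move β rfl
  follower r hr := by
    obtain ⟨v, ha, hv⟩ := h.follower r hr
    by_cases hx : v = x.1
    · exact ⟨_, h.activeAt_next_of_lead β hr (hx ▸ ha), fun _ => rfl⟩
    · refine ⟨v, h.toRunning.activeAt_next_of_idle β hr ha (absurd · hx), fun hs => ?_⟩
      exact absurd (hv (hs.resolve_left hx)) hx

/-- All followers are at `w` and none of them has terminated. -/
structure Parked (I : Instance V R) (σ : R → Status V (shepherding main).Mem) (P : Prog)
    (x : V × Option ℕ) (w : V) : Prop extends I.Running σ P x where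
  follower : ∀ r, I.IsFollower r → (σ r).ActiveAt w

theorem Parked.lead (h : I.Parked σ (.lead m P) x x.1) (β : R → ByzAct Command) :
    I.Parked (I.next (shepherding main) σ β) P (I.G.traverse x (m (I.view x)))
      (I.G.traverse x (m (I.view x))).1 where
  toRunning := h.toRunning.move β rfl
  follower r hr := h.activeAt_next_of_lead β hr (h.follower r hr)

theorem Parked.solo (h : I.Parked σ (.solo m nxt) x w) (β : R → ByzAct Command) :
    I.Parked (I.next (shepherding main) σ β)
      (nxt (I.view x) (I.received (shepherding main) σ β I.shepherd))
      (I.G.traverse x (m (I.view x))) w where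
  toRunning := h.toRunning.move β rfl
  follower r hr := h.toRunning.activeAt_next_of_idle β hr (h.follower r hr) fun _ =>
    ⟨List.not_mem_nil, rfl⟩

theorem Parked.card_received_le (h : I.Parked σ P x w) (hx : x.1 ≠ w) (β : R → ByzAct Command) :
    (I.received (shepherding main) σ β I.shepherd).card ≤ I.byz.card := by
  rw [card_received, h.place_shepherd, ← Set.ncard_coe_finset]
  refine Set.ncard_le_ncard fun r hr => ?_
  by_contra hb
  exact hx (hr.2.symm.trans (h.follower r ⟨hb, hr.1⟩).2)

theorem Parked.card_le_card_received (h : I.Parked σ P x x.1) (β : R → ByzAct Command) :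
    Fintype.card R ≤
      (I.received (shepherding main) σ β I.shepherd).card + I.byz.card + 1 := by
  rw [card_received, h.place_shepherd, ← Set.ncard_coe_finset, ← Nat.card_eq_fintype_card,
    ← Set.ncard_univ]
  refine le_trans (Set.ncard_le_ncard fun r _ => ?_)
    ((Set.ncard_insert_le I.shepherd _).trans (Nat.succ_le_succ (Set.ncard_union_le _ _)))
  by_cases hr : r = I.shepherd
  · exact .inl hr
  · by_cases hb : r ∈ I.byz
    · exact .inr (.inr hb)
    · exact .inr (.inl ⟨hr, (h.follower r ⟨hb, hr⟩).2⟩)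

theorem Parked.card_le_two_mul_card_received_iff (h : I.Parked σ P x w)
    (hk : 2 * I.byz.card + 1 < Fintype.card R) (β : R → ByzAct Command) :
    Fintype.card R ≤ 2 * (I.received (shepherding main) σ β I.shepherd).card ↔ x.1 = w := by
  by_cases hx : x.1 = w
  · subst hx
    have := h.card_le_card_received β
    exact iff_of_true (by omega) rfl
  · have := h.card_received_le hx β
    exact iff_of_false (by omega) hx

variable [Fintype V] {β : ℕ → R → ByzAct Command} {t : ℕ} {U : List ℤ}

theorem Gathering.leadUxs (h : I.Gathering (I.run (shepherding main) β t) (.leadUxs U P) x seen) :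
    ∃ z, I.Gathering (I.run (shepherding main) β (t + U.length)) P z
      (seen ∪ {w | w ∈ (U.scanl I.G.uxsStep x).map Prod.fst}) := by
  induction U generalizing x seen t with
  | nil =>
    refine ⟨x, h.toRunning, fun r hr => ?_⟩
    obtain ⟨v, ha, hv⟩ := h.follower r hr
    exact ⟨v, ha, fun hs => hs.elim hv fun hs => by simpa using hs⟩
  | cons a U ih =>
    obtain ⟨z, hz⟩ := ih (t := t + 1) (Gathering.lead h (β t))
    refine ⟨z, ?_⟩
    convert hz using 1
    · rw [List.length_cons, add_comm U.length, add_assoc]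
    · ext w
      simp [portUxs, view, PortGraph.uxsStep, or_assoc, or_left_comm]

/-- The followers are with the shepherd at `v` and none of them has terminated. -/
def Assembled (I : Instance V R) (σ : R → Status V (shepherding main).Mem) (P : Prog) (v : V) :
    Prop :=
  ∃ x : V × Option ℕ, x.1 = v ∧ I.Parked σ P x v

theorem exists_assembled_run_of_gather (hU : I.G.ExploredBy U)
    (hmain : main (Fintype.card V) (Fintype.card R) = .gather U P) (β : ℕ → R → ByzAct Command) :
    ∃ v, I.Assembled (I.run (shepherding main) β (uxsRounds U)) P v := by
  have hstart : I.Gathering (I.run (shepherding main) β 0) (.gather U P)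
      (I.start I.shepherd, none) ∅ := by
    refine ⟨⟨?_, rfl, rfl, fun r hr => if_neg hr.2⟩, fun r _ => ⟨_, ⟨rfl, rfl⟩, fun h => h.elim⟩⟩
    rw [← hmain]
    simp [run, init]
  obtain ⟨z, hz⟩ := Gathering.leadUxs (t := 1) (hstart.lead (β 0))
  refine ⟨z.1, z, rfl, ?_, fun r hr => ?_⟩
  · simpa only [uxsRounds, add_comm U.length, Nat.zero_add] using hz.toRunning
  · obtain ⟨v, ha, hv⟩ := hz.follower r hr
    obtain rfl : v = z.1 := hv <| by simpa [PortGraph.uxsVisited] using hU (I.start I.shepherd) v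
    simpa only [uxsRounds, add_comm U.length, Nat.zero_add] using ha

end Instance

/-! ### Exploration with a token -/

namespace Prog

/-- The shepherd walks alone along `s` and notes whether it meets the token: a node with at least
half as many other robots as there are robots in total, `k`. -/
def scout (k : ℕ) : MarkedWalk → (Bool → Prog) → Prog
  | [], next => next false
  | b :: s, next =>
    solo (portMod b.1) fun _ M => scout k s fun found => next (decide (k ≤ 2 * M.card) || found)

/-- The token is brought through port `p`; the shepherd inspects the closed walk `W` and fetches
the token back. The result is the port leading back if the token was not found on `W`. -/
def probe (k p : ℕ) (W : MarkedWalk) (next : Option ℕ → Prog) : Prog :=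
  lead (portMod p) <|
    solo (fun v => portMod (portBack v) v) fun v _ =>
      scout k (W ++ [(p, false)]) fun found =>
        lead (portMod (portBack v)) <| next (if found then none else some (portBack v))

/-- The listed ports are probed at the end of the walk `A`, where `A ++ B` is a closed walk;
detours to the new nodes are inserted in front of `B`. -/
def probeAll (k : ℕ) (A : MarkedWalk) : List ℕ → MarkedWalk → (MarkedWalk → Prog) → Prog
  | [], B, next => next B
  | p :: ps, B, next => probe k p (B ++ A) fun
    | none => probeAll k A ps B next
    | some q => probeAll k A ps ((p, true) :: (q, false) :: B) next

/-- All ports are probed at all nodes of the growing closed walk `A ++ B`, beginning at the end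
of `A`. The number `fuel` bounds the number of the remaining steps of the walk. -/
def explore (k n : ℕ) (next : MarkedWalk → Prog) : (fuel : ℕ) → (A B : MarkedWalk) → Prog
  | 0, _, _ => halt
  | fuel + 1, A, B => probeAll k A (List.range n) B fun
    | [] => next A
    | b :: B' => lead (portMod b.1) (explore k n next fuel (A ++ [b]) B')

end Prog

namespace Instance

variable {V R : Type} [Fintype R] {I : Instance V R} {main : ℕ → ℕ → Prog}
  {σ : R → Status V (shepherding main).Mem} {P : Prog} {x : V × Option ℕ} {v w : V} {p : ℕ}

theorem Parked.lead_portMod (h : I.Parked σ (.lead (portMod p) P) x x.1)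
    (β : R → ByzAct Command) :
    I.Parked (I.next (shepherding main) σ β) P (I.G.traverse x (p % I.G.deg x.1))
      (I.G.go x.1 p) :=
  I.G.fst_traverse_mod x p ▸ h.lead β

theorem Assembled.lead_portMod (h : I.Assembled σ (.lead (portMod p) P) v)
    (β : R → ByzAct Command) :
    I.Assembled (I.next (shepherding main) σ β) P (I.G.go v p) := by
  obtain ⟨x, rfl, hx⟩ := h
  exact ⟨_, I.G.fst_traverse_mod x p, hx.lead_portMod β⟩

variable [Fintype V] {β : ℕ → R → ByzAct Command} {t : ℕ} {W : MarkedWalk}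

open Classical in
theorem Parked.scout (hk : 2 * I.byz.card + 1 < Fintype.card R) {s : MarkedWalk}
    {next : Bool → Prog}
    (h : I.Parked (I.run (shepherding main) β t) (.scout (Fintype.card R) s next) x w) :
    ∃ y : V × Option ℕ, y.1 = I.G.endpoint x.1 s ∧
      I.Parked (I.run (shepherding main) β (t + s.length))
        (next (decide (w ∈ I.G.passed x.1 s))) y w := by
  induction s generalizing x t next with
  | nil => exact ⟨x, rfl, by simpa [PortGraph.passed, Prog.scout] using h⟩
  | cons b s ih =>
    obtain ⟨y, hy, h'⟩ := ih (t := t + 1) (Parked.solo h (β t))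
    have hstep : (I.G.traverse x (portMod b.1 (I.view x))).1 = I.G.go x.1 b.1 :=
      I.G.fst_traverse_mod x b.1
    have hmeets := h.card_le_two_mul_card_received_iff hk (β t)
    refine ⟨y, by rw [hy, hstep, PortGraph.endpoint_cons], ?_⟩
    convert h' using 2
    · rw [List.length_cons, add_comm s.length, add_assoc]
    · simp [PortGraph.passed, hmeets, hstep, eq_comm]

theorem Assembled.probe (hk : 2 * I.byz.card + 1 < Fintype.card R) {next : Option ℕ → Prog}
    (hW : I.G.endpoint v W = v)
    (h : I.Assembled (I.run (shepherding main) β t) (.probe (Fintype.card R) p W next) v) :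
    (I.G.go v p ∈ v :: I.G.passed v W ∧
        I.Assembled (I.run (shepherding main) β (t + (W.length + 4))) (next none) v) ∨
      (I.G.go v p ∉ v :: I.G.passed v W ∧ ∃ q, I.G.go (I.G.go v p) q = v ∧
        I.Assembled (I.run (shepherding main) β (t + (W.length + 4))) (next (some q)) v) := by
  classical
  obtain ⟨x, rfl, hx⟩ := h
  have hq := I.G.go_entry x p
  have hy := I.G.fst_traverse_mod x p
  have hbrought := hx.lead_portMod (β t)
  generalize I.G.traverse x (p % I.G.deg x.1) = y at hq hy hbrought
  set q := portBack (I.view y)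
  replace hq : I.G.go (I.G.go x.1 p) q = x.1 := hq
  have hz : (I.G.traverse y (portMod q (I.view y))).1 = x.1 := by
    rw [← hq, ← hy]
    exact I.G.fst_traverse_mod y q
  obtain ⟨y', hy', hscouted⟩ :=
    Parked.scout (t := t + 1 + 1) hk (Parked.solo hbrought (β (t + 1)))
  rw [hz] at hscouted hy'
  simp only [PortGraph.endpoint_append, hW, PortGraph.endpoint_cons, PortGraph.endpoint_nil] at hy'
  have hfetched := Assembled.lead_portMod ⟨y', hy', hscouted⟩
    (β (t + 1 + 1 + (W ++ [(p, false)]).length))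
  rw [hq] at hfetched
  have hfound : I.G.go x.1 p ∈ I.G.passed x.1 (W ++ [(p, false)]) ↔
      I.G.go x.1 p ∈ x.1 :: I.G.passed x.1 W := by
    simp [PortGraph.passed_append, PortGraph.passed, hW, or_comm]
  have htime : t + 1 + 1 + (W ++ [(p, false)]).length + 1 = t + (W.length + 4) := by
    simp only [List.length_append, List.length_singleton]
    ring
  rw [← htime]
  by_cases hmem : I.G.go x.1 p ∈ x.1 :: I.G.passed x.1 W
  · rw [decide_eq_true (hfound.2 hmem)] at hfetched
    exact .inl ⟨hmem, hfetched⟩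
  · rw [decide_eq_false (hfound.not.2 hmem)] at hfetched
    exact .inr ⟨hmem, q, hq, hfetched⟩

section Explore

variable (hk : 2 * I.byz.card + 1 < Fintype.card R) {r : V} {A B : MarkedWalk}
  {next : MarkedWalk → Prog} (hM : I.G.IsMap r A B)
include hk hM

theorem Assembled.probeAll_cons {ps : List ℕ}
    (h : I.Assembled (I.run (shepherding main) β t)
      (.probeAll (Fintype.card R) A (p :: ps) B next) (I.G.endpoint r A)) :
    ∃ t' ≤ t + (2 * Fintype.card V + 2), ∃ B', I.G.IsMap r A B' ∧
      I.G.discovered r (A ++ B) ⊆ I.G.discovered r (A ++ B') ∧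
      I.G.go (I.G.endpoint r A) p ∈ I.G.discovered r (A ++ B') ∧
      I.Assembled (I.run (shepherding main) β t')
        (.probeAll (Fintype.card R) A ps B' next) (I.G.endpoint r A) := by
  have hlen : (B ++ A).length + 2 ≤ 2 * Fintype.card V := by
    simpa [add_comm] using hM.length_add_two_le
  refine ⟨t + ((B ++ A).length + 4), by omega, ?_⟩
  have hprobe := Assembled.probe hk (PortGraph.endpoint_rotate_of_closed hM.closed) h
  rw [hM.mem_passed_rotate_iff] at hprobe
  rcases hprobe with ⟨hp, h'⟩ | ⟨hp, q, hq, h'⟩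
  · exact ⟨B, hM, List.Subset.refl _, hp, h'⟩
  · have hperm := PortGraph.discovered_detour_perm (B := B) hq
    exact ⟨_, hM.insert hq hp, fun v hv => hperm.mem_iff.2 (List.mem_cons_of_mem _ hv),
      hperm.mem_iff.2 List.mem_cons_self, h'⟩

theorem Assembled.probeAll {ps : List ℕ}
    (h : I.Assembled (I.run (shepherding main) β t)
      (.probeAll (Fintype.card R) A ps B next) (I.G.endpoint r A)) :
    ∃ t' ≤ t + ps.length * (2 * Fintype.card V + 2), ∃ B', I.G.IsMap r A B' ∧
      I.G.discovered r (A ++ B) ⊆ I.G.discovered r (A ++ B') ∧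
      (∀ p ∈ ps, I.G.go (I.G.endpoint r A) p ∈ I.G.discovered r (A ++ B')) ∧
      I.Assembled (I.run (shepherding main) β t') (next B') (I.G.endpoint r A) := by
  induction ps generalizing B t with
  | nil => exact ⟨t, by simp, B, hM, List.Subset.refl _, by simp, h⟩
  | cons p ps ih =>
    obtain ⟨t₁, ht₁, B₁, hM₁, hsub₁, hp, h₁⟩ := Assembled.probeAll_cons hk hM h
    obtain ⟨t₂, ht₂, B₂, hM₂, hsub₂, hps, h₂⟩ := ih hM₁ h₁
    refine ⟨t₂, ?_, B₂, hM₂, List.Subset.trans hsub₁ hsub₂, ?_, h₂⟩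
    · rw [List.length_cons, Nat.succ_mul]
      omega
    · exact List.forall_mem_cons.2 ⟨hsub₂ hp, hps⟩

theorem Assembled.explore (hG : I.G.graph.Connected) {fuel : ℕ}
    (hfuel : 2 * Fintype.card V ≤ fuel + A.length)
    (h : I.Assembled (I.run (shepherding main) β t)
      (.explore (Fintype.card R) (Fintype.card V) next fuel A B) (I.G.endpoint r A)) :
    ∃ t' ≤ t + fuel * (Fintype.card V * (2 * Fintype.card V + 2) + 1), ∃ s : MarkedWalk,
      s.length ≤ 2 * Fintype.card V ∧ (I.G.discovered r s).Nodup ∧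
      (∀ v, v ∈ I.G.discovered r s) ∧
      I.Assembled (I.run (shepherding main) β t') (next s) r := by
  induction fuel generalizing A B t with
  | zero =>
    have := hM.length_add_two_le
    rw [List.length_append] at this
    omega
  | succ fuel ih =>
    obtain ⟨t₁, ht₁, B₁, hM₁, -, hports, h₁⟩ := Assembled.probeAll hk hM h
    rw [List.length_range] at ht₁
    rw [Nat.succ_mul]
    have hend : ∀ w, I.G.graph.Adj (I.G.endpoint r A) w → w ∈ I.G.discovered r (A ++ B₁) := by
      intro w hw
      obtain ⟨p, hp, rfl⟩ := I.G.exists_go_eq_of_adj hw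
      exact hports p (List.mem_range.2 (hp.trans_le (I.G.deg_le_card _)))
    cases B₁ with
    | nil =>
      have hclosed := hM₁.closed
      have hnodup := hM₁.nodup
      have hlen := hM₁.length_add_two_le
      simp only [List.append_nil] at hclosed hnodup hlen hend
      rw [hclosed] at h₁
      exact ⟨t₁, by omega, A, by omega, hnodup, hM₁.mem_discovered hG hend, h₁⟩
    | cons b B₂ =>
      obtain ⟨t₂, ht₂, hs⟩ := ih (t := t₁ + 1) (hM₁.advance hend)
        (by rw [List.length_append, List.length_singleton]; omega)
        (by rw [PortGraph.endpoint_append]; exact h₁.lead_portMod (β t₁))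
      exact ⟨t₂, by omega, hs⟩

end Explore

end Instance

/-! ### Settling -/

namespace Prog

/-- The first robots in the list `L`, as many as the node can hold, settle. If there is room for
one more, the shepherd settles, too. -/
def settle (L : List ℕ) (next : List ℕ → Prog) : Prog :=
  .round (fun v => (⟨L.take v.capacity, none⟩,
      if L.length < v.capacity then .terminate else .stay))
    fun v _ => next (L.drop v.capacity)

/-- The robots in the list `L` are led along a walk and settle at the nodes entered by the marked
steps. -/
def tour : MarkedWalk → List ℕ → Prog
  | [], _ => halt
  | (p, true) :: s, L => lead (portMod p) <| settle L (tour s)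
  | (p, false) :: s, L => lead (portMod p) <| tour s L

/-- The shepherd lists the IDs shown by the other robots at its node. -/
def rollCall (next : List ℕ → Prog) : Prog :=
  .round (fun _ => (⟨[], none⟩, .stay)) fun _ M => next ((M.map Shout.label).sort (· ≤ ·))

/-- The program of the shepherd, where `U` is an exploration sequence for the graph. -/
def dispersion (U : List ℤ) (n k : ℕ) : Prog :=
  gather U <| explore k n (fun s => rollCall fun L => settle L (tour s)) (2 * n) [] []

end Prog

namespace Instance

variable {V R : Type} {I : Instance V R}

variable (I) in
/-- The followers that have terminated at node `u`. -/
def settled {Mem : Type} (σ : R → Status V Mem) (u : V) : Set R :=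
  {r | I.IsFollower r ∧ (σ r).SettledAt u}

theorem dispersed_of_settledAt [Finite R] {v : V} {Mem : Type} {σ : R → Status V Mem}
    (hshepherd : (σ I.shepherd).SettledAt v)
    (hfollower : ∀ r, I.IsFollower r → (σ r).halted = true)
    (hcap : ∀ u ≠ v, (I.settled σ u).ncard ≤ I.cap u) (hv : (I.settled σ v).ncard < I.cap v) :
    I.Dispersed σ := by
  refine ⟨fun r hb => ?_, fun u => ?_⟩
  · by_cases hr : r = I.shepherd
    · exact hr ▸ hshepherd.1
    · exact hfollower r ⟨hb, hr⟩
  · by_cases hu : u = v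
    · subst hu
      refine (Set.ncard_le_ncard ?_).trans ((Set.ncard_insert_le I.shepherd _).trans hv)
      rintro r ⟨hb, hp⟩
      by_cases hr : r = I.shepherd
      · exact .inl hr
      · exact .inr ⟨⟨hb, hr⟩, hfollower r ⟨hb, hr⟩, hp⟩
    · refine (Set.ncard_le_ncard ?_).trans (hcap u hu)
      rintro r ⟨hb, hp⟩
      have hr : r ≠ I.shepherd := by
        rintro rfl
        exact hu (hp.symm.trans hshepherd.2)
      exact ⟨⟨hb, hr⟩, hfollower r ⟨hb, hr⟩, hp⟩

variable {main : ℕ → ℕ → Prog} {σ : R → Status V (shepherding main).Mem} {P : Prog}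
  {x : V × Option ℕ} {v : V} {L : List ℕ} {S : List V}

variable (I σ P x L S) in
/-- The followers with IDs in `L` are with the shepherd at place `x`, the others have settled
outside `S` within the capacities, and the nodes in `S` have room for `L` and the shepherd. -/
structure Settling : Prop extends I.Running σ P x where
  follower : ∀ r, I.IsFollower r →
    (σ r).ActiveAt x.1 ∧ I.id r ∈ L ∨ ∃ u ∉ S, (σ r).SettledAt u
  ncard_le : ∀ u, (I.settled σ u).ncard ≤ I.cap u
  nodup : S.Nodup
  length_lt : L.length < (S.map I.cap).sum

theorem Settling.settled_eq_empty (h : I.Settling σ P x L S) (hv : v ∈ S) : I.settled σ v = ∅ := by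
  refine Set.eq_empty_of_forall_notMem fun r ⟨hr, hs⟩ => ?_
  rcases h.follower r hr with ⟨ha, -⟩ | ⟨u, hu, hs'⟩
  · exact ha.not_settledAt hs
  · exact hu (hs'.2.symm.trans hs.2 ▸ hv)

variable [Fintype R] {next : List ℕ → Prog}

namespace Settling

theorem lead_portMod {p : ℕ} (h : I.Settling σ (.lead (portMod p) P) x L S)
    (β : R → ByzAct Command) :
    ∃ y : V × Option ℕ, y.1 = I.G.go x.1 p ∧
      I.Settling (I.next (shepherding main) σ β) P y L S := by
  have hsettled : ∀ r, I.IsFollower r → ∀ u,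
      ((I.next (shepherding main) σ β r).SettledAt u ↔ (σ r).SettledAt u) := fun r hr u =>
    (h.toRunning.settledAt_next_iff β hr).trans <|
      or_iff_left fun hs => List.not_mem_nil hs.2.2
  refine ⟨_, I.G.fst_traverse_mod x p, h.toRunning.move β rfl, fun r hr => ?_, fun u => ?_,
    h.nodup, h.length_lt⟩
  · rcases h.follower r hr with ⟨ha, hL⟩ | ⟨u, hu, hs⟩
    · exact .inl ⟨h.activeAt_next_of_lead β hr ha, hL⟩
    · exact .inr ⟨u, hu, (hsettled r hr u).2 hs⟩
  · refine (congrArg Set.ncard ?_).trans_le (h.ncard_le u)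
    exact Set.ext fun r => and_congr_right fun hr => hsettled r hr u

variable (h : I.Settling σ (.settle L next) x L (x.1 :: S)) (β : R → ByzAct Command)
include h

theorem settled_next_of_ne {u : V} (hu : u ≠ x.1) :
    I.settled (I.next (shepherding main) σ β) u = I.settled σ u :=
  Set.ext fun _ => and_congr_right fun hr =>
    (h.toRunning.settledAt_next_iff β hr).trans (or_iff_left fun hs => hu hs.1)

theorem ncard_settled_next_le :
    (I.settled (I.next (shepherding main) σ β) x.1).ncard ≤ min (I.cap x.1) L.length := by
  rw [← List.length_take]
  calc
    _ ≤ ((L.take (I.cap x.1)).toFinset : Set ℕ).ncard := by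
      refine Set.ncard_le_ncard_of_injOn I.id (fun r ⟨hr, hs⟩ => ?_) I.id_injective.injOn
      rcases (h.toRunning.settledAt_next_iff β hr).1 hs with hs | ⟨-, -, hL⟩
      · exact absurd ⟨hr, hs⟩ (h.settled_eq_empty List.mem_cons_self ▸ Set.notMem_empty r)
      · exact List.mem_toFinset.2 hL
    _ ≤ _ := by
      rw [Set.ncard_coe_finset]
      exact List.toFinset_card_le _

theorem follower_next {r : R} (hr : I.IsFollower r) :
    ((I.next (shepherding main) σ β r).ActiveAt x.1 ∧ I.id r ∈ L.drop (I.cap x.1)) ∨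
      ∃ u ∉ S, (I.next (shepherding main) σ β r).SettledAt u := by
  have hsettled := fun v => h.toRunning.settledAt_next_iff (v := v) β hr
  rcases h.follower r hr with ⟨ha, hL⟩ | ⟨u, hu, hs⟩
  · by_cases htake : I.id r ∈ L.take (I.cap x.1)
    · exact .inr ⟨x.1, (List.nodup_cons.1 h.nodup).1, (hsettled _).2 (.inr ⟨rfl, ha, htake⟩)⟩
    · refine .inl ⟨h.toRunning.activeAt_next_of_idle β hr ha fun _ => ⟨htake, rfl⟩, ?_⟩
      rw [← List.take_append_drop (I.cap x.1) L, List.mem_append] at hL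
      exact hL.resolve_left htake
  · exact .inr ⟨u, fun hS => hu (List.mem_cons_of_mem _ hS), (hsettled u).2 (.inl hs)⟩

theorem dispersed_next_of_length_lt (hL : L.length < I.cap x.1) :
    I.Dispersed (I.next (shepherding main) σ β) := by
  refine dispersed_of_settledAt (v := x.1) ?_ (fun r hr => ?_) (fun u hu => ?_) ?_
  · rw [h.toRunning.next_shepherd β]
    simp [Status.SettledAt, view, hL, act]
  · rcases h.follower_next β hr with ⟨-, hdrop⟩ | ⟨u, -, hs⟩
    · simp [List.drop_eq_nil_of_le hL.le] at hdrop
    · exact hs.1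
  · exact h.settled_next_of_ne β hu ▸ h.ncard_le u
  · exact (h.ncard_settled_next_le β).trans_lt (min_lt_of_right_lt hL)

theorem next_of_le_length (hL : I.cap x.1 ≤ L.length) :
    I.Settling (I.next (shepherding main) σ β) (next (L.drop (I.cap x.1))) x
      (L.drop (I.cap x.1)) S where
  toRunning := h.toRunning.stay β (by simp [view, hL.not_gt])
  follower r hr := h.follower_next β hr
  ncard_le u := by
    by_cases hu : u = x.1
    · exact hu ▸ (h.ncard_settled_next_le β).trans (min_le_left ..)
    · exact h.settled_next_of_ne β hu ▸ h.ncard_le u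
  nodup := (List.nodup_cons.1 h.nodup).2
  length_lt := by
    have := h.length_lt
    rw [List.map_cons, List.sum_cons] at this
    rw [List.length_drop]
    omega

theorem dispersed_or_next :
    I.Dispersed (I.next (shepherding main) σ β) ∨
      ∃ L', I.Settling (I.next (shepherding main) σ β) (next L') x L' S :=
  (lt_or_ge L.length (I.cap x.1)).imp (h.dispersed_next_of_length_lt β) fun hL =>
    ⟨_, h.next_of_le_length β hL⟩

end Settling

theorem Assembled.rollCall (h : I.Assembled σ (.rollCall next) v) (hS : S.Nodup)
    (hcap : Fintype.card R ≤ (S.map I.cap).sum) (β : R → ByzAct Command) :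
    ∃ x : V × Option ℕ, x.1 = v ∧
      ∃ L, I.Settling (I.next (shepherding main) σ β) (next L) x L S := by
  obtain ⟨x, rfl, hx⟩ := h
  have hactive : ∀ r, I.IsFollower r → (I.next (shepherding main) σ β r).ActiveAt x.1 :=
    fun r hr => hx.toRunning.activeAt_next_of_idle β hr (hx.follower r hr) fun _ =>
      ⟨List.not_mem_nil, rfl⟩
  refine ⟨x, rfl, _, hx.toRunning.stay β rfl, fun r hr => .inl ⟨hactive r hr, ?_⟩, fun u => ?_,
    hS, lt_of_lt_of_le ?_ hcap⟩
  · rw [Multiset.mem_sort, Multiset.mem_map]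
    refine ⟨_, mem_received.2 ⟨r, ⟨hr.2, ?_⟩, rfl⟩, by simp [shout, hr.1]⟩
    rw [(hx.follower r hr).2, hx.place_shepherd]
  · have : I.settled (I.next (shepherding main) σ β) u = ∅ :=
      Set.eq_empty_of_forall_notMem fun r hr => (hactive r hr.1).not_settledAt hr.2
    simp [this]
  · rw [Multiset.length_sort, Multiset.card_map, card_received, ← Nat.card_eq_fintype_card]
    exact Set.ncard_lt_card fun hall => (Set.eq_univ_iff_forall.1 hall I.shepherd).1 rfl

variable [Fintype V] {β : ℕ → R → ByzAct Command} {t : ℕ}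

theorem Settling.tour {s : MarkedWalk}
    (h : I.Settling (I.run (shepherding main) β t) (.tour s L) x L (I.G.marked x.1 s)) :
    ∃ t' ≤ t + 2 * s.length, I.Dispersed (I.run (shepherding main) β t') := by
  induction s generalizing x L t with
  | nil => exact absurd h.length_lt (Nat.not_lt_zero _)
  | cons b s ih =>
    rw [List.length_cons]
    obtain ⟨p, _ | _⟩ := b
    · obtain ⟨y, hy, h₁⟩ := Settling.lead_portMod h (β t)
      rw [PortGraph.marked, ← hy] at h₁
      obtain ⟨t', ht', hd⟩ := ih (t := t + 1) h₁
      exact ⟨t', by omega, hd⟩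
    · obtain ⟨y, hy, h₁⟩ := Settling.lead_portMod h (β t)
      rw [PortGraph.marked, ← hy] at h₁
      rcases h₁.dispersed_or_next (β (t + 1)) with hd | ⟨L', h₂⟩
      · exact ⟨t + 1 + 1, by omega, hd⟩
      · obtain ⟨t', ht', hd⟩ := ih (t := t + 1 + 1) h₂
        exact ⟨t', by omega, hd⟩

theorem Assembled.rollCall_settle_tour {s : MarkedWalk} (hs : (I.G.discovered v s).Nodup)
    (hall : ∀ u, u ∈ I.G.discovered v s) (hcap : Fintype.card R ≤ ∑ u, I.cap u)
    (h : I.Assembled (I.run (shepherding main) β t)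
      (.rollCall fun L => .settle L (.tour s)) v) :
    ∃ t' ≤ t + 2 + 2 * s.length, I.Dispersed (I.run (shepherding main) β t') := by
  classical
  have hsum : ((I.G.discovered v s).map I.cap).sum = ∑ u, I.cap u := by
    rw [← List.sum_toFinset _ hs, Finset.eq_univ_of_forall fun u => List.mem_toFinset.2 (hall u)]
  obtain ⟨x, rfl, L, hx⟩ := Assembled.rollCall h hs (hsum ▸ hcap) (β t)
  rcases hx.dispersed_or_next (β (t + 1)) with hd | ⟨L', h'⟩
  · exact ⟨t + 1 + 1, by omega, hd⟩
  · exact Settling.tour (t := t + 1 + 1) h'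

theorem solvedWithin_dispersion {U : ℕ → List ℤ} (hG : I.G.graph.Connected)
    (hU : I.G.ExploredBy (U (Fintype.card V))) (hcap : Fintype.card R ≤ ∑ v, I.cap v)
    (hk : 2 * I.byz.card + 1 < Fintype.card R) :
    I.SolvedWithin (shepherding fun n => Prog.dispersion (U n) n)
      (16 * (uxsRounds (U (Fintype.card V)) + Fintype.card V ^ 3)) := by
  intro β
  obtain ⟨v, hgathered⟩ := exists_assembled_run_of_gather hU rfl β
  obtain ⟨t₁, ht₁, s, hlen, hnodup, hall, hexplored⟩ :=
    Assembled.explore hk PortGraph.IsMap.nil hG (Nat.le_add_right ..) hgathered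
  obtain ⟨t₂, ht₂, hdispersed⟩ := hexplored.rollCall_settle_tour hnodup hall hcap
  refine ⟨t₂, ?_, hdispersed⟩
  have hpos : 1 ≤ Fintype.card V := Fintype.card_pos_iff.2 ⟨v⟩
  generalize Fintype.card V = n at *
  have hpoly : 2 * n * (n * (2 * n + 2) + 1) + 2 + 4 * n ≤ 16 * n ^ 3 := by
    nlinarith [Nat.pow_le_pow_right hpos (show 1 ≤ 3 by norm_num),
      Nat.pow_le_pow_right hpos (show 2 ≤ 3 by norm_num), Nat.one_le_pow 3 n hpos]
  omega

end Instance

end Dispersion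

theorem theorem1_general :
    (∀ n : ℕ, ∃ U : List ℤ, Dispersion.IsUXS n U) ∧
    ∃ C : ℕ, ∀ U : ℕ → List ℤ, ∃ A : Dispersion.Algorithm,
      ∀ (n k f : ℕ) (V R : Type) [Fintype V] [Fintype R] (I : Dispersion.Instance V R),
        Fintype.card V = n → Fintype.card R = k →
        I.G.graph.Connected → I.G.ExploredBy (U n) →
        k ≤ ∑ v, I.cap v →
        I.byz.card ≤ f → f < k / 2 →
        I.SolvedWithin A (C * (Dispersion.uxsRounds (U n) + n ^ 3)) := by
  refine ⟨Dispersion.exists_isUXS, 16, fun U =>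
    ⟨Dispersion.shepherding fun n => Dispersion.Prog.dispersion (U n) n, ?_⟩⟩
  rintro n k f V R _ _ I rfl rfl hG hU hcap hf hk
  exact I.solvedWithin_dispersion hG hU hcap (by omega)

theorem theorem1 :
    (∀ n : ℕ, ∃ U : List ℤ, Dispersion.IsUXS n U) ∧
    ∃ C : ℕ, ∀ U : ℕ → List ℤ, ∃ A : Dispersion.Algorithm,
      ∀ (n k f : ℕ) (V R : Type) [Fintype V] [Fintype R] (I : Dispersion.Instance V R),
        Fintype.card V = n → Fintype.card R = k →
        I.G.graph.Connected → I.G.ExploredBy (U n) →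
        k ≤ ∑ v, I.cap v →
        I.byz.card ≤ f → f < (k - 1) / 2 →
        I.SolvedWithin A (C * (Dispersion.uxsRounds (U n) + n ^ 3)) := by
  obtain ⟨huxs, C, hC⟩ := theorem1_general
  exact ⟨huxs, C, fun U => (hC U).imp fun A hA n k f V R _ _ I hn hk hG hU hcap hf hfk =>
    hA n k f V R I hn hk hG hU hcap hf (by omega)⟩
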